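/- **Setting: a language of rank-polymorphic tensor rewrite rules.** *Names.* There is a finite set of rank classes $c_1,\dots,c_p$. Each aggregated axis $x$ belongs to exactly one rank class. A rank map $r$ assigns a rank $r_i\in\mathbb N$ to every $c_i$; at these ranks every aggregated axis of class $c_i$ stands for $r_i$ named axes, numbered $1,\dots,r_i$, and every map over $c_i$ (size, stride, padding, index, …) is a function $\{1,\dots,r_i\}\to\mathbb Z$. Maps are given by terms $m::= v \mid \mathrm{fmap}(f,m,\dots,m)$, with $v$ a map variable over the class and $f:\mathbb Z^n\to\mathbb Z$ applied pointwise; a term may be used for any aggregated axis of its class. Each input tensor $t$ has an element type (integer, Boolean or real), a finite set of aggregated axes, and on each of them a size given by a map term. An *access* $A$ gives an integer $A_{x,i}$ for every named axis $(x,i)$; it is valid for an expression if $0\le A_{x,i}<\text{size}_{x,i}$ on all its axes. *Expressions.* An expression $e$ has a finite set of aggregated axes, a size $s_{x,i}$ on every named axis, validity conditions (below; subexpressions must also be valid, and "all" refers to all named axes of $e$), and an element $e[A]$ at every access. Operands of binary, dyup-slice, concat, select must have the same axes. - literal tensors of fixed content, all of whose axes are required to be singletons; input tensors (sizes $\ge0$);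 $\mathrm{const}(v)$ of a given nonnegative shape; $\mathrm{iota}_x$ of given nonnegative shape with element $A_x$, where $x$ is one of its axes and is required to be a singleton; - $\mathrm{expand}(e)$: adds new axes with sizes $\ge 0$, the element ignoring them; $\mathrm{binary}_\oplus(e,e')$: elementwise, equal shapes, $\oplus$ any function on scalars; $\mathrm{select}(b,e,e')$: elementwise choice, equal shapes; $\mathrm{clamp}$ is an abbreviation through $\min$ and $\max$; $\mathrm{relabel}$: injective renaming of axes within their rank classes; - $\mathrm{padlow}(e,v,S_l)$: size $s+S_l\ge0$; the element is $e[A-S_l]$ if $S_l\le A$ on all axes, else $v$; - $\mathrm{pad}(e,v,S_l,S_h,S_i)$: $S_i\ge0$, size $s+(s-1)S_i+S_l+S_h\ge0$; the element is $e[(A-S_l)/(S_i+1)]$ if on all axes $S_l\le A<s+(s-1)S_i+S_l$ and $(S_i+1)\mid A-S_l$, else $v$; - $\mathrm{slice}(e,I_s,I_e,I_p)$: $0\le I_s\le I_e\le s$, $I_p>0$, size $\lceil (I_e-I_s)/I_p\rceil$, element $e[I_s+A I_p]$; $\mathrm{dyslice}(e,I,s')$: $0\le I$, $0<s'$, $I+s'\le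 s$, size $s'$, element $e[A+I]$; $\mathrm{dyupslice}(e,u,I)$: with $s_u$ the size of $u$, $0\le I$, $0<s_u$, $I+s_u\le s$, size $s$, element $u[A-I]$ if $I\le A<I+s_u$ on all axes, else $e[A]$; - $\mathrm{concat}_x(e,e')$: $x$ is required to be a singleton; equal sizes except on $x$, where the sizes add up; with $S''$ equal to the size of $e$ on $x$ and $0$ elsewhere, the element is $e'[A-S'']$ if $S''\le A$ on all axes, else $e[A]$; $\mathrm{reverse}_X(e)$: element $e[A']$ with $A'=s-A-1$ on the axes $X$ and $A'=A$ elsewhere; - $\mathrm{reduce}_\oplus(e,X,\ell)$: removes the axes $X$ of $e$; its element is the reduction by $\oplus$ of the element of $e$ at the access whose components on $X$ are the *symbolic reduction indices* $(\ell,x)$, $x\in X$, ranging from $0$ to the size minus one, and which agrees with $A$ elsewhere; - $\mathrm{dot}(e,e',X_c,X_b)$: the common axes are the disjoint union of $X_c$ and $X_b$, and $e,e'$ have the same sizes on them; it is the sum over $X_c$ of the products; $\mathrm{convbase}(e,w,X_b,X_f,X_o,I_p)$: $X_b$ are the axes of $e$ not in $w$, $X_o$ those of $w$ not in $e$, $X_f$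 is a set of common axes on which $e,w$ have equal sizes, and the other common axes are spatial with stride $I_p>0$; output axes are $X_b$, $X_o$ and the spatial ones, the latter of size $\lfloor(s_e-s_w)/I_p\rfloor+1\ge0$; the element is the sum, with reduction indices $\sigma$ over the sizes of $w$ on $X_f$ and the spatial axes, of $e$ (at $\sigma$ on $X_f$, $A I_p+\sigma$ on spatial axes, $A$ on $X_b$) times $w$ (at $\sigma$ on these axes, $A$ on $X_o$); general $\mathrm{conv}$ is the abbreviation through $\mathrm{pad}$. *Reduction elements* are not evaluated. A reduction over no axes is the identity; every other one is kept as a triple (operator, set of symbolic indices, summand). Products of a scalar with a sum, or of two sums with disjoint index sets, and nested reductions by one operator over disjoint index sets, are merged to a single such triple; all other arithmetic on reduction elements (and selection by one) is unsupported. *Rules.* A rule $R$ consists of two expressions $\mathit{lhs},\mathit{rhs}$ of the same element type, a finite list of preconditions, each built by $\wedge,\vee$ from folds, and a hint, a conjunction of folds. A fold over a class $c_i$ is a predicate on map terms over $c_i$ that is required at every position $1,\dots,r_i$; in hints the maps may also be symbolic reduction indices. Symbolic indices of the two sides are *related* if both are in range and satisfy the hint. *Validity at ranks $r$.* $r$ is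 admissible if every axis required to be a singleton by $\mathit{lhs}$ or $\mathit{rhs}$ belongs to a class of rank $1$. $R$ is *valid at $r$* if $r$ is not admissible, or if for all values of the map variables and all contents of the input tensors such that all preconditions hold and $\mathit{lhs}$ is valid: $\mathit{rhs}$ is valid; both sides have the same axes and shape; on each side a symbolic index used several times always has the same range, and the relation is a bijection between the in-range symbolic indices of the two sides; and at every valid access the elements agree, meaning that they are equal scalars, or reduction elements with the same operator, each over all symbolic indices of its side, whose summands are supported and equal whenever the symbolic indices are related. *The bound.* Evaluate both sides symbolically at one general access. This yields accesses $(t,\alpha)$ to input tensors, and one condition for each pad, padlow, dyupslice and concat occurring, which is a conjunction of folds, one per aggregated axis. Accesses and conditions are distinguished as functions of map variables, symbolic reduction indices and the components of the general access. Let $n_t$ be the number of distinct accesses to $t$ in both sides together, and let $q_i$ be the number of distinct conditions that contain, for some aggregated axis of class $c_i$, a fold whose predicate is not identically true. Put $$\mathrm{InferBound}(R,c_i)=\max\Bigl(1,\; q_i+\sum_{t}\binom{n_t}{2}\Bigr),$$ the sum being over the input tensors $t$ that occur in $R$ and have an aggregated axis of class $c_i$. **Theorem.** Let $R$ be any rule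 in this language, with rank classes $c_1,\dots,c_p$, and let $k_i=\mathrm{InferBound}(R,c_i)$. Then $R$ is valid at all ranks $(r_1,\dots,r_p)$ with $r_i\ge1$ (for arbitrary sizes, attributes and tensor contents) if and only if $R$ is valid at all ranks with $1\le r_i\le k_i$ for all $i$. -/

import Mathlib

namespace TensorDSL

open Classical

noncomputable section

/-! ### Scalars and operators on scalars -/

/-- Element types. -/
inductive DType
  | int
  | bool
  | real

/-- Values of an element type. -/
abbrev DType.El : DType → Type
  | .int => ℤ
  | .bool => Bool
  | .real => ℝ

def DType.zero : (τ : DType) → τ.El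
  | .int => (0 : ℤ)
  | .bool => false
  | .real => (0 : ℝ)

/-- Addition; on booleans this is disjunction. -/
def DType.add : (τ : DType) → τ.El → τ.El → τ.El
  | .int => fun (a b : ℤ) => a + b
  | .bool => fun (a b : Bool) => a || b
  | .real => fun (a b : ℝ) => a + b

/-- Multiplication; on booleans this is conjunction. -/
def DType.mul : (τ : DType) → τ.El → τ.El → τ.El
  | .int => fun (a b : ℤ) => a * b
  | .bool => fun (a b : Bool) => a && b
  | .real => fun (a b : ℝ) => a * b

def DType.min : (τ : DType) → τ.El → τ.El → τ.El
  | .int => fun (a b : ℤ) => Min.min (α := ℤ) a b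
  | .bool => fun (a b : Bool) => a && b
  | .real => fun (a b : ℝ) => Min.min (α := ℝ) a b

def DType.max : (τ : DType) → τ.El → τ.El → τ.El
  | .int => fun (a b : ℤ) => Max.max (α := ℤ) a b
  | .bool => fun (a b : Bool) => a || b
  | .real => fun (a b : ℝ) => Max.max (α := ℝ) a b

/-- Binary scalar operators. Addition and multiplication are singled out because the arithmetic
of reduction elements refers to them; every other operator is given by its function. -/
inductive BinOp : DType → DType → DType → Type
  | add (τ : DType) : BinOp τ τ τ
  | mul (τ : DType) : BinOp τ τ τ
  | fn {σ τ υ : DType} (f : σ.El → τ.El → υ.El) : BinOp σ τ υ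

def BinOp.eval : {σ τ υ : DType} → BinOp σ τ υ → σ.El → τ.El → υ.El
  | _, _, _, .add τ => τ.add
  | _, _, _, .mul τ => τ.mul
  | _, _, _, .fn f => f

/-! ### Names and maps -/

/-- Maps `m ::= variable | fmap(f, m, ..., m)`; `V` is the type of map variables. A function of
no arguments gives the constant maps. -/
inductive MapTerm (V : Type) : Type
  | var (v : V) : MapTerm V
  | fmap {n : ℕ} (f : (Fin n → ℤ) → ℤ) (args : Fin n → MapTerm V) : MapTerm V

/-- The value of a map at one named axis, given the values of the map variables there. -/
def MapTerm.eval {V : Type} (ℓ : V → ℤ) : MapTerm V → ℤ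
  | .var v => ℓ v
  | .fmap f args => f (fun j => (args j).eval ℓ)

/-- The constant map. -/
def MapTerm.cst {V : Type} (k : ℤ) : MapTerm V := .fmap (n := 0) (fun _ => k) Fin.elim0

/-- The names a rule is written with: rank classes, the aggregated axes of each rank class (each
aggregated axis is in exactly one class), the map variables over each class, the names for families
of symbolic reduction indices, and the input tensors with their element type, their finite set of
aggregated axes and their shape. -/
structure Sig where
  RClass : Type
  Axis : RClass → Type
  MapVar : RClass → Type
  Label : Type
  TVar : Type
  dtype : TVar → DType
  taxes : TVar → Finset (Σ c, Axis c)
  tshape : TVar → ∀ x : (Σ c, Axis c), MapTerm (MapVar x.1)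

/-- Aggregated axes. -/
abbrev Sig.Agg (S : Sig) : Type := Σ c, S.Axis c

/-- Aggregated maps as they occur in expressions. Only the values on the relevant aggregated axes
matter. -/
abbrev Sig.Attr (S : Sig) : Type := ∀ x : S.Agg, MapTerm (S.MapVar x.1)

/-- Symbolic reduction indices: the label of a reduction together with the reduced axis. -/
abbrev Sig.SI (S : Sig) : Type := S.Label × S.Agg

/-! ### Tensor expressions -/

/-- Tensor expressions with elements of a given type. -/
inductive Expr (S : Sig) : DType → Type
  /-- literal tensor; all its axes are singletons -/
  | lit {τ : DType} (D : Finset S.Agg) (size : S.Agg → ℕ) (f : (D → ℤ) → τ.El) : Expr S τ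
  | var (t : S.TVar) : Expr S (S.dtype t)
  | const {τ : DType} (v : τ.El) (D : Finset S.Agg) (sh : S.Attr) : Expr S τ
  | iota (D : Finset S.Agg) (sh : S.Attr) (x : S.Agg) : Expr S .int
  | expand {τ : DType} (e : Expr S τ) (D : Finset S.Agg) (sh : S.Attr) : Expr S τ
  | binary {σ τ υ : DType} (op : BinOp σ τ υ) (e : Expr S σ) (e' : Expr S τ) : Expr S υ
  | padLow {τ : DType} (e : Expr S τ) (v : τ.El) (Sl : S.Attr) : Expr S τ
  /-- low, high and interior padding -/
  | pad {τ : DType} (e : Expr S τ) (v : τ.El) (Sl Sh Si : S.Attr) : Expr S τ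
  /-- start, end (exclusive), stride -/
  | slice {τ : DType} (e : Expr S τ) (Is Ie Ip : S.Attr) : Expr S τ
  | dySlice {τ : DType} (e : Expr S τ) (I sh : S.Attr) : Expr S τ
  | dyupSlice {τ : DType} (e eu : Expr S τ) (I : S.Attr) : Expr S τ
  /-- reduction over the axes in `X`, with symbolic reduction indices `(l, x)` for `x ∈ X` -/
  | reduce {τ : DType} (op : BinOp τ τ τ) (e : Expr S τ) (X : Finset S.Agg) (l : S.Label) :
      Expr S τ
  /-- renaming of aggregated axes within their rank classes; injective renamings of the
  finitely many axes of `e` are exactly the restrictions of permutations -/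
  | relabel {τ : DType} (e : Expr S τ) (R : ∀ c, Equiv.Perm (S.Axis c)) : Expr S τ
  | concat {τ : DType} (e e' : Expr S τ) (x : S.Agg) : Expr S τ
  /-- convolution without padding and dilation: batch axes `Xb`, input-feature axes `Xf`,
  output-feature axes `Xo`, strides `Ip` -/
  | convBase {τ : DType} (ei ew : Expr S τ) (Xb Xf Xo : Finset S.Agg) (Ip : S.Attr)
      (l : S.Label) : Expr S τ
  /-- contraction axes `Xc`, batch axes `Xb` -/
  | dot {τ : DType} (e e' : Expr S τ) (Xc Xb : Finset S.Agg) (l : S.Label) : Expr S τ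
  | select {τ : DType} (eb : Expr S .bool) (e e' : Expr S τ) : Expr S τ
  | reverse {τ : DType} (e : Expr S τ) (X : Finset S.Agg) : Expr S τ

variable {S : Sig}

/-- `clamp` is an abbreviation. -/
def Expr.clamp {τ : DType} (emin e emax : Expr S τ) : Expr S τ :=
  .binary (.fn τ.min) (.binary (.fn τ.max) e emin) emax

/-- General convolution (dilations `Si`, `Si'`) is an abbreviation. -/
def Expr.conv {τ : DType} (ei ew : Expr S τ) (Xb Xf Xo : Finset S.Agg)
    (Sl Sh Si Si' Ip : S.Attr) (l : S.Label) : Expr S τ :=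
  .convBase
    (.pad ei τ.zero Sl Sh (fun x => .fmap (n := 1) (fun a => a 0 - 1) (fun _ => Si x)))
    (.pad ew τ.zero (fun _ => .cst 0) (fun _ => .cst 0)
      (fun x => .fmap (n := 1) (fun a => a 0 - 1) (fun _ => Si' x)))
    Xb Xf Xo Ip l

/-- The aggregated axes of a tensor expression. -/
def Expr.axes : {τ : DType} → Expr S τ → Finset S.Agg
  | _, .lit D _ _ => D
  | _, .var t => S.taxes t
  | _, .const _ D _ => D
  | _, .iota D _ _ => D
  | _, .expand e D _ => e.axes ∪ D
  | _, .binary _ e _ => e.axes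
  | _, .padLow e _ _ => e.axes
  | _, .pad e _ _ _ _ => e.axes
  | _, .slice e _ _ _ => e.axes
  | _, .dySlice e _ _ => e.axes
  | _, .dyupSlice e _ _ => e.axes
  | _, .reduce _ e X _ => e.axes \ X
  | _, .relabel e R => e.axes.image (fun x => ⟨x.1, R x.1 x.2⟩)
  | _, .concat e _ _ => e.axes
  | _, .convBase ei _ Xb Xf Xo _ _ => Xb ∪ Xo ∪ (ei.axes \ (Xb ∪ Xf))
  | _, .dot e e' Xc _ _ => (e.axes ∪ e'.axes) \ Xc
  | _, .select _ e _ => e.axes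
  | _, .reverse e _ => e.axes

/-- The shape of a tensor expression: the size at a named axis of `x`, as a function of the values
of the map variables there. -/
def Expr.shape : {τ : DType} → Expr S τ → ∀ x : S.Agg, (S.MapVar x.1 → ℤ) → ℤ
  | _, .lit _ size _ => fun x _ => size x
  | _, .var t => fun x ℓ => (S.tshape t x).eval ℓ
  | _, .const _ _ sh => fun x ℓ => (sh x).eval ℓ
  | _, .iota _ sh _ => fun x ℓ => (sh x).eval ℓ
  | _, .expand e D sh => fun x ℓ => if x ∈ D then (sh x).eval ℓ else e.shape x ℓ
  | _, .binary _ e _ => e.shape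
  | _, .padLow e _ Sl => fun x ℓ => e.shape x ℓ + (Sl x).eval ℓ
  | _, .pad e _ Sl Sh Si => fun x ℓ =>
      e.shape x ℓ + (e.shape x ℓ - 1) * (Si x).eval ℓ + (Sl x).eval ℓ + (Sh x).eval ℓ
  -- the rounded-up quotient of `Ie - Is` by `Ip`
  | _, .slice _ Is Ie Ip => fun x ℓ => -(((Is x).eval ℓ - (Ie x).eval ℓ) / (Ip x).eval ℓ)
  | _, .dySlice _ _ sh => fun x ℓ => (sh x).eval ℓ
  | _, .dyupSlice e _ _ => e.shape
  | _, .reduce _ e _ _ => e.shape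
  | _, .relabel e R => fun x => e.shape ⟨x.1, (R x.1).symm x.2⟩
  | _, .concat e e' x₀ => fun x ℓ => if x = x₀ then e.shape x ℓ + e'.shape x ℓ else e.shape x ℓ
  | _, .convBase ei ew Xb _ Xo Ip _ => fun x ℓ =>
      if x ∈ Xb then ei.shape x ℓ
      else if x ∈ Xo then ew.shape x ℓ
      else (ei.shape x ℓ - ew.shape x ℓ) / (Ip x).eval ℓ + 1
  | _, .dot e e' _ _ _ => fun x ℓ => if x ∈ e.axes then e.shape x ℓ else e'.shape x ℓ
  | _, .select _ e _ => e.shape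
  | _, .reverse e _ => e.shape

/-- The aggregated axes that are required to be singletons. -/
def Expr.singletons : {τ : DType} → Expr S τ → Finset S.Agg
  | _, .lit D _ _ => D
  | _, .var _ => ∅
  | _, .const _ _ _ => ∅
  | _, .iota _ _ x => {x}
  | _, .expand e _ _ => e.singletons
  | _, .binary _ e e' => e.singletons ∪ e'.singletons
  | _, .padLow e _ _ => e.singletons
  | _, .pad e _ _ _ _ => e.singletons
  | _, .slice e _ _ _ => e.singletons
  | _, .dySlice e _ _ => e.singletons
  | _, .dyupSlice e eu _ => e.singletons ∪ eu.singletons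
  | _, .reduce _ e _ _ => e.singletons
  | _, .relabel e _ => e.singletons
  | _, .concat e e' x => insert x (e.singletons ∪ e'.singletons)
  | _, .convBase ei ew _ _ _ _ _ => ei.singletons ∪ ew.singletons
  | _, .dot e e' _ _ _ => e.singletons ∪ e'.singletons
  | _, .select eb e e' => eb.singletons ∪ (e.singletons ∪ e'.singletons)
  | _, .reverse e _ => e.singletons

/-! ### Instantiation at concrete ranks

A rank map `m` instantiates every aggregated axis `x` of rank class `c` to `m c` named axes, numbered
by `Fin (m c)`. The canonical bijection between two aggregated axes of the same class preserves the
number, so a map over a rank class is a function on `Fin (m c)`. -/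

/-- Values of the map variables. -/
abbrev MapEnv (S : Sig) (m : S.RClass → ℕ) : Type := ∀ c, S.MapVar c → Fin (m c) → ℤ

/-- Integer-valued nested maps, used as accesses. -/
abbrev Idx (S : Sig) (m : S.RClass → ℕ) : Type := ∀ x : S.Agg, Fin (m x.1) → ℤ

/-- Values of the symbolic reduction indices. -/
abbrev SIEnv (S : Sig) (m : S.RClass → ℕ) : Type := S.Label → Idx S m

/-- Contents of the input tensors: functions of the indices of their own axes. -/
abbrev TenEnv (S : Sig) (m : S.RClass → ℕ) : Type :=
  ∀ t : S.TVar, ((x : S.taxes t) → Fin (m x.1.1) → ℤ) → (S.dtype t).El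

variable {m : S.RClass → ℕ}

/-- The values of the map variables at one named axis. -/
def MapEnv.at (ρ : MapEnv S m) (c : S.RClass) (i : Fin (m c)) : S.MapVar c → ℤ := fun v => ρ c v i

/-- The value of an aggregated map. -/
def MapEnv.attr (ρ : MapEnv S m) (M : S.Attr) : Idx S m := fun x i => (M x).eval (ρ.at x.1 i)

/-- The concrete shape of an expression. -/
def Expr.shapeAt {τ : DType} (e : Expr S τ) (ρ : MapEnv S m) : Idx S m :=
  fun x i => e.shape x (ρ.at x.1 i)

/-- A property holds at all named axes of all aggregated axes in `D`. -/
def AllOn (m : S.RClass → ℕ) (D : Finset S.Agg) (p : ∀ x : S.Agg, Fin (m x.1) → Prop) : Prop :=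
  ∀ x ∈ D, ∀ i, p x i

/-- Valid accesses for an expression. -/
def Expr.IsAccess {τ : DType} (e : Expr S τ) (ρ : MapEnv S m) (A : Idx S m) : Prop :=
  AllOn m e.axes fun x i => 0 ≤ A x i ∧ A x i < e.shapeAt ρ x i

/-- Validity of a tensor expression: the premises of the operator semantics. -/
def Expr.Valid (ρ : MapEnv S m) : {τ : DType} → Expr S τ → Prop
  | _, .lit _ _ _ => True
  | _, .var t => AllOn m (S.taxes t) fun x i => 0 ≤ ρ.attr (S.tshape t) x i
  | _, .const _ D sh => AllOn m D fun x i => 0 ≤ ρ.attr sh x i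
  | _, .iota D sh x₀ => x₀ ∈ D ∧ AllOn m D fun x i => 0 ≤ ρ.attr sh x i
  | _, .expand e D sh =>
      e.Valid ρ ∧ Disjoint D e.axes ∧ AllOn m D fun x i => 0 ≤ ρ.attr sh x i
  | _, .binary _ e e' =>
      e.Valid ρ ∧ e'.Valid ρ ∧ e.axes = e'.axes ∧
      AllOn m e.axes fun x i => e.shapeAt ρ x i = e'.shapeAt ρ x i
  | _, .padLow e _ Sl =>
      e.Valid ρ ∧ AllOn m e.axes fun x i => 0 ≤ e.shapeAt ρ x i + ρ.attr Sl x i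
  | _, .pad e _ Sl Sh Si =>
      e.Valid ρ ∧ AllOn m e.axes fun x i => 0 ≤ ρ.attr Si x i ∧
        0 ≤ e.shapeAt ρ x i + (e.shapeAt ρ x i - 1) * ρ.attr Si x i + ρ.attr Sl x i
          + ρ.attr Sh x i
  | _, .slice e Is Ie Ip =>
      e.Valid ρ ∧ AllOn m e.axes fun x i => 0 ≤ ρ.attr Is x i ∧ ρ.attr Is x i ≤ ρ.attr Ie x i ∧
        ρ.attr Ie x i ≤ e.shapeAt ρ x i ∧ 0 < ρ.attr Ip x i
  | _, .dySlice e I sh =>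
      e.Valid ρ ∧ AllOn m e.axes fun x i => ρ.attr I x i + ρ.attr sh x i ≤ e.shapeAt ρ x i ∧
        0 < ρ.attr sh x i ∧ 0 ≤ ρ.attr I x i
  | _, .dyupSlice e eu I =>
      e.Valid ρ ∧ eu.Valid ρ ∧ e.axes = eu.axes ∧
      AllOn m e.axes fun x i => ρ.attr I x i + eu.shapeAt ρ x i ≤ e.shapeAt ρ x i ∧
        0 < eu.shapeAt ρ x i ∧ 0 ≤ ρ.attr I x i
  | _, .reduce _ e X _ => e.Valid ρ ∧ X ⊆ e.axes
  | _, .relabel e _ => e.Valid ρ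
  | _, .concat e e' x₀ =>
      e.Valid ρ ∧ e'.Valid ρ ∧ e.axes = e'.axes ∧ x₀ ∈ e.axes ∧
      AllOn m e.axes fun x i => x ≠ x₀ → e.shapeAt ρ x i = e'.shapeAt ρ x i
  | _, .convBase ei ew Xb Xf Xo Ip _ =>
      ei.Valid ρ ∧ ew.Valid ρ ∧ Xb = ei.axes \ ew.axes ∧ Xo = ew.axes \ ei.axes ∧
      Xf ⊆ ei.axes ∩ ew.axes ∧
      (AllOn m Xf fun x i => ei.shapeAt ρ x i = ew.shapeAt ρ x i) ∧
      AllOn m (ei.axes \ (Xb ∪ Xf)) fun x i => 0 < ρ.attr Ip x i ∧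
        0 ≤ (ei.shapeAt ρ x i - ew.shapeAt ρ x i) / ρ.attr Ip x i + 1
  | _, .dot e e' Xc Xb _ =>
      e.Valid ρ ∧ e'.Valid ρ ∧ Xc ∪ Xb = e.axes ∩ e'.axes ∧ Disjoint Xc Xb ∧
      AllOn m (e.axes ∩ e'.axes) fun x i => e.shapeAt ρ x i = e'.shapeAt ρ x i
  | _, .select eb e e' =>
      eb.Valid ρ ∧ e.Valid ρ ∧ e'.Valid ρ ∧ eb.axes = e.axes ∧ e.axes = e'.axes ∧
      (AllOn m e.axes fun x i => eb.shapeAt ρ x i = e.shapeAt ρ x i) ∧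
      AllOn m e.axes fun x i => e.shapeAt ρ x i = e'.shapeAt ρ x i
  | _, .reverse e X => e.Valid ρ ∧ X ⊆ e.axes

/-! ### Elements, reduction elements, denotations -/

/-- Elements of tensors: scalars, uninterpreted reduction elements, and the error element for
unsupported arithmetic on reduction elements. `red op I v` is the reduction with operator `op` over
the symbolic reduction indices in `I`; `v` is the summand at the values that these indices currently
have (`none` if the summand is not supported). -/
inductive Elem (S : Sig) (τ : DType) : Type
  | err : Elem S τ
  | val (v : τ.El) : Elem S τ
  | red (op : BinOp τ τ τ) (I : Finset S.SI) (v : Option τ.El) : Elem S τ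

/-- Binary operators on elements. On reduction elements only products with sums are supported. -/
def Elem.binary : {σ τ υ : DType} → BinOp σ τ υ → Elem S σ → Elem S τ → Elem S υ
  | _, _, _, op, .val a, .val b => .val (op.eval a b)
  | _, _, _, .mul τ, .val a, .red (.add _) I v => .red (.add τ) I (v.map fun b => τ.mul a b)
  | _, _, _, .mul τ, .red (.add _) I v, .val b => .red (.add τ) I (v.map fun a => τ.mul a b)
  | _, _, _, .mul τ, .red (.add _) I v, .red (.add _) J w =>
      if Disjoint I J then
        .red (.add τ) (I ∪ J) (v.bind fun a => w.map fun b => τ.mul a b)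
      else .err
  | _, _, _, _, _, _ => .err

/-- Reduction of an element over the symbolic reduction indices in `J`; nested reductions with the
same operator and different indices are merged. A reduction over no indices (such as a `dot` without
contraction axes) does nothing. -/
def Elem.reduce {τ : DType} (op : BinOp τ τ τ) (J : Finset S.SI) (u : Elem S τ) : Elem S τ :=
  if J = ∅ then u
  else
    match u with
    | .val v => .red op J (some v)
    | .red op' I v =>
        if op' = op ∧ Disjoint I J then .red op (I ∪ J) v else .red op (I ∪ J) none
    | .err => .red op J none

def Elem.select {τ : DType} : Elem S .bool → Elem S τ → Elem S τ → Elem S τ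
  | .val b, u, v => if b = true then u else v
  | _, _, _ => .err

/-- The symbolic reduction indices with label `l` for the axes in `X`. -/
def siSet (l : S.Label) (X : Finset S.Agg) : Finset S.SI := X.image fun x => (l, x)

/-- The element of a tensor expression at an access `A`. -/
def Expr.denote (ρ : MapEnv S m) (θ : TenEnv S m) (s : SIEnv S m) :
    {τ : DType} → Expr S τ → Idx S m → Elem S τ
  -- the axes of a literal are singletons, so that it is indexed by one number per axis
  | _, .lit _ _ f, A => .val (f fun x => if h : 0 < m x.1.1 then A x.1 ⟨0, h⟩ else 0)
  | _, .var t, A => .val (θ t fun x => A x.1)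
  | _, .const v _ _, _ => .val v
  | _, .iota _ _ x, A => .val (if h : 0 < m x.1 then A x ⟨0, h⟩ else 0 : ℤ)
  | _, .expand e _ _, A => e.denote ρ θ s A
  | _, .binary op e e', A => Elem.binary op (e.denote ρ θ s A) (e'.denote ρ θ s A)
  | _, .padLow e v Sl, A =>
      if AllOn m e.axes fun x i => ρ.attr Sl x i ≤ A x i
      then e.denote ρ θ s (fun x i => A x i - ρ.attr Sl x i)
      else .val v
  | _, .pad e v Sl _ Si, A =>
      if AllOn m e.axes fun x i => ρ.attr Sl x i ≤ A x i ∧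
          A x i < e.shapeAt ρ x i + (e.shapeAt ρ x i - 1) * ρ.attr Si x i + ρ.attr Sl x i ∧
          (A x i - ρ.attr Sl x i) % (ρ.attr Si x i + 1) = 0
      then e.denote ρ θ s (fun x i => (A x i - ρ.attr Sl x i) / (ρ.attr Si x i + 1))
      else .val v
  | _, .slice e Is _ Ip, A => e.denote ρ θ s (fun x i => ρ.attr Is x i + A x i * ρ.attr Ip x i)
  | _, .dySlice e I _, A => e.denote ρ θ s (fun x i => A x i + ρ.attr I x i)
  | _, .dyupSlice e eu I, A =>
      if AllOn m e.axes fun x i => ρ.attr I x i ≤ A x i ∧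
          A x i < ρ.attr I x i + eu.shapeAt ρ x i
      then eu.denote ρ θ s (fun x i => A x i - ρ.attr I x i)
      else e.denote ρ θ s A
  | _, .reduce op e X l, A =>
      Elem.reduce op (siSet l X) (e.denote ρ θ s fun x i => if x ∈ X then s l x i else A x i)
  | _, .relabel e R, A => e.denote ρ θ s (fun x => A ⟨x.1, R x.1 x.2⟩)
  | _, .concat e e' x₀, A =>
      if AllOn m e.axes fun x i => (if x = x₀ then e.shapeAt ρ x i else 0) ≤ A x i
      then e'.denote ρ θ s (fun x i => A x i - if x = x₀ then e.shapeAt ρ x i else 0)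
      else e.denote ρ θ s A
  | _, .convBase (τ := τ) ei ew Xb Xf _ Ip l, A =>
      Elem.reduce (.add τ) (siSet l (Xf ∪ (ei.axes \ (Xb ∪ Xf))))
        (Elem.binary (.mul τ)
          (ei.denote ρ θ s fun x i =>
            if x ∈ Xf then s l x i
            else if x ∈ ei.axes \ (Xb ∪ Xf) then A x i * ρ.attr Ip x i + s l x i
            else A x i)
          (ew.denote ρ θ s fun x i =>
            if x ∈ Xf ∪ (ei.axes \ (Xb ∪ Xf)) then s l x i else A x i))
  | _, .dot (τ := τ) e e' Xc _ l, A =>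
      Elem.reduce (.add τ) (siSet l Xc)
        (Elem.binary (.mul τ)
          (e.denote ρ θ s fun x i => if x ∈ Xc then s l x i else A x i)
          (e'.denote ρ θ s fun x i => if x ∈ Xc then s l x i else A x i))
  | _, .select eb e e', A =>
      Elem.select (eb.denote ρ θ s A) (e.denote ρ θ s A) (e'.denote ρ θ s A)
  | _, .reverse e X, A =>
      e.denote ρ θ s (fun x i => if x ∈ X then e.shapeAt ρ x i - A x i - 1 else A x i)

/-- The occurrences of symbolic reduction indices in an expression, each with the size of the
reduced axis. -/
def Expr.siOcc : {τ : DType} → Expr S τ →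
    List (S.Label × (Σ x : S.Agg, ((S.MapVar x.1 → ℤ) → ℤ)))
  | _, .lit _ _ _ => []
  | _, .var _ => []
  | _, .const _ _ _ => []
  | _, .iota _ _ _ => []
  | _, .expand e _ _ => e.siOcc
  | _, .binary _ e e' => e.siOcc ++ e'.siOcc
  | _, .padLow e _ _ => e.siOcc
  | _, .pad e _ _ _ _ => e.siOcc
  | _, .slice e _ _ _ => e.siOcc
  | _, .dySlice e _ _ => e.siOcc
  | _, .dyupSlice e eu _ => e.siOcc ++ eu.siOcc
  | _, .reduce _ e X l => X.toList.map (fun x => (l, ⟨x, e.shape x⟩)) ++ e.siOcc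
  | _, .relabel e _ => e.siOcc
  | _, .concat e e' _ => e.siOcc ++ e'.siOcc
  | _, .convBase ei ew Xb Xf _ _ l =>
      (Xf ∪ (ei.axes \ (Xb ∪ Xf))).toList.map (fun x => (l, ⟨x, ew.shape x⟩)) ++
        (ei.siOcc ++ ew.siOcc)
  | _, .dot e e' Xc _ l =>
      Xc.toList.map (fun x => (l, ⟨x, e.shape x⟩)) ++ (e.siOcc ++ e'.siOcc)
  | _, .select eb e e' => eb.siOcc ++ (e.siOcc ++ e'.siOcc)
  | _, .reverse e _ => e.siOcc

/-- The set of symbolic reduction indices occurring in an expression. -/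
def Expr.sis {τ : DType} (e : Expr S τ) : Finset S.SI :=
  (e.siOcc.map fun o => (o.1, o.2.1)).toFinset

/-- The symbolic reduction indices of `e` have values in range. -/
def Expr.InRange {τ : DType} (e : Expr S τ) (ρ : MapEnv S m) (s : SIEnv S m) : Prop :=
  ∀ o ∈ e.siOcc, ∀ i, 0 ≤ s o.1 o.2.1 i ∧ s o.1 o.2.1 i < o.2.2 (ρ.at o.2.1.1 i)

/-- A symbolic reduction index that is used several times always ranges over the same size. -/
def Expr.SIConsistent {τ : DType} (e : Expr S τ) (ρ : MapEnv S m) : Prop :=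
  ∀ l x f g, (l, ⟨x, f⟩) ∈ e.siOcc → (l, ⟨x, g⟩) ∈ e.siOcc →
    ∀ i, f (ρ.at x.1 i) = g (ρ.at x.1 i)

/-! ### Preconditions, hints, rules -/

/-- `fold(g, m, ..., m)` over a rank class; `V` gives the map variables. -/
structure Fold (S : Sig) (V : S.RClass → Type) where
  cls : S.RClass
  arity : ℕ
  pred : (Fin arity → ℤ) → Prop
  args : Fin arity → MapTerm (V cls)

/-- A fold holds if its predicate holds at every named axis. -/
def Fold.Holds {V : S.RClass → Type} (F : Fold S V) (ρ : ∀ c, V c → Fin (m c) → ℤ) : Prop :=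
  ∀ i : Fin (m F.cls), F.pred fun j => (F.args j).eval fun v => ρ F.cls v i

/-- Preconditions: built from folds by conjunction and disjunction. -/
inductive Pre (S : Sig) : Type
  | fold (F : Fold S S.MapVar) : Pre S
  | and (p q : Pre S) : Pre S
  | or (p q : Pre S) : Pre S

def Pre.Holds (ρ : MapEnv S m) : Pre S → Prop
  | .fold F => F.Holds ρ
  | .and p q => p.Holds ρ ∧ q.Holds ρ
  | .or p q => p.Holds ρ ∨ q.Holds ρ

/-- Map variables available in hints: the map variables of the rule and the symbolic reduction
indices. -/
abbrev HintVar (S : Sig) (c : S.RClass) : Type := S.MapVar c ⊕ (S.Label × S.Axis c)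

/-- A rewrite rule: two expressions, a list of preconditions, and a hint (a conjunction of folds)
relating the symbolic reduction indices of the two sides. -/
structure Rule (S : Sig) where
  τ : DType
  lhs : Expr S τ
  rhs : Expr S τ
  pre : List (Pre S)
  hint : List (Fold S (HintVar S))

/-- The relation on symbolic reduction indices that the hint describes. -/
def Rule.Related (R : Rule S) (ρ : MapEnv S m) (s : SIEnv S m) : Prop :=
  R.lhs.InRange ρ s ∧ R.rhs.InRange ρ s ∧
    ∀ F ∈ R.hint, F.Holds (m := m) fun c v i =>
      match v with
      | .inl v => ρ c v i
      | .inr (l, a) => s l ⟨c, a⟩ i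

/-- Two values of the symbolic reduction indices agree on `I`. -/
def AgreeOn (I : Finset S.SI) (s s' : SIEnv S m) : Prop := ∀ p ∈ I, s p.1 p.2 = s' p.1 p.2

/-- The hint describes a bijection between the reduction indices of the left-hand side and those of
the right-hand side. -/
def Rule.HintBijective (R : Rule S) (ρ : MapEnv S m) : Prop :=
  R.lhs.SIConsistent ρ ∧ R.rhs.SIConsistent ρ ∧
  (∀ s : SIEnv S m, R.lhs.InRange ρ s → ∃ s', AgreeOn R.lhs.sis s s' ∧ R.Related ρ s') ∧
  (∀ s : SIEnv S m, R.rhs.InRange ρ s → ∃ s', AgreeOn R.rhs.sis s s' ∧ R.Related ρ s') ∧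
  ∀ s s' : SIEnv S m, R.Related ρ s → R.Related ρ s' →
    (AgreeOn R.lhs.sis s s' ↔ AgreeOn R.rhs.sis s s')

/-- Agreement of a left-hand and a right-hand element: equal scalars, or reduction elements with the
same operator, over all the reduction indices of the respective side, that have the same summand
whenever the indices are related (`rel`). -/
def Elem.Agree {τ : DType} (I J : Finset S.SI) (rel : Prop) : Elem S τ → Elem S τ → Prop
  | .val a, .val b => a = b
  | .red op I' v, .red op' J' w =>
      op = op' ∧ I' = I ∧ J' = J ∧ (rel → ∃ a, v = some a ∧ w = some a)
  | _, _ => False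

/-- The ranks are admissible for the singleton requirements of the operators in the rule. -/
def Rule.Admissible (R : Rule S) (m : S.RClass → ℕ) : Prop :=
  ∀ x ∈ R.lhs.singletons ∪ R.rhs.singletons, m x.1 = 1

/-- Validity of the rule at concrete ranks, for arbitrary sizes, attributes and tensor contents:
if the precondition holds and the left-hand side is valid, then the right-hand side is valid and
denotes the same tensor. -/
def Rule.Valid (R : Rule S) (m : S.RClass → ℕ) : Prop :=
  R.Admissible m → ∀ (ρ : MapEnv S m) (θ : TenEnv S m),
    (∀ p ∈ R.pre, p.Holds ρ) → R.lhs.Valid ρ →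
      R.rhs.Valid ρ ∧
      R.lhs.axes = R.rhs.axes ∧
      (AllOn m R.lhs.axes fun x i => R.lhs.shapeAt ρ x i = R.rhs.shapeAt ρ x i) ∧
      R.HintBijective ρ ∧
      ∀ A : Idx S m, R.lhs.IsAccess ρ A → ∀ s : SIEnv S m,
        Elem.Agree R.lhs.sis R.rhs.sis (R.Related ρ s)
          (R.lhs.denote ρ θ s A) (R.rhs.denote ρ θ s A)

/-! ### Symbolic evaluation and the bound -/

/-- The values of everything that an index or a condition may depend on at one named axis of a rank
class: map variables, symbolic reduction indices, and the indices of the general access. -/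
structure Loc (S : Sig) (c : S.RClass) where
  map : S.MapVar c → ℤ
  si : S.Label → S.Axis c → ℤ
  acc : S.Axis c → ℤ

/-- Symbolic accesses: an index transformer for every aggregated axis. -/
abbrev SymIdx (S : Sig) : Type := ∀ x : S.Agg, Loc S x.1 → ℤ

/-- Symbolic accesses to input tensors. -/
abbrev SymAccess (S : Sig) : Type := Σ t : S.TVar, ((x : S.taxes t) → Loc S x.1.1 → ℤ)

/-- Conditions: a conjunction of folds, one for every aggregated axis; a fold is trivial if its
predicate is constantly true. -/
abbrev SymCond (S : Sig) : Type := ∀ x : S.Agg, Loc S x.1 → Prop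

/-- The symbolic access in which the axes in `X` are indexed by symbolic reduction indices. -/
def SymIdx.withSI (I : SymIdx S) (l : S.Label) (X : Finset S.Agg) : SymIdx S :=
  fun x ℓ => if x ∈ X then ℓ.si l x.2 else I x ℓ

/-- The distinct accesses to input tensors and the distinct conditions that occur in the symbolic
evaluation of an expression at a symbolic access. -/
def Expr.scalarfArgs : {τ : DType} → Expr S τ → SymIdx S → Finset (SymAccess S ⊕ SymCond S)
  | _, .lit _ _ _, _ => ∅
  | _, .var t, I => {.inl ⟨t, fun x => I x.1⟩}
  | _, .const _ _ _, _ => ∅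
  | _, .iota _ _ _, _ => ∅
  | _, .expand e _ _, I => e.scalarfArgs I
  | _, .binary _ e e', I => e.scalarfArgs I ∪ e'.scalarfArgs I
  | _, .padLow e _ Sl, I =>
      insert (.inr fun x ℓ => x ∈ e.axes → (Sl x).eval ℓ.map ≤ I x ℓ)
        (e.scalarfArgs fun x ℓ => I x ℓ - (Sl x).eval ℓ.map)
  | _, .pad e _ Sl _ Si, I =>
      insert
        (.inr fun x ℓ => x ∈ e.axes → (Sl x).eval ℓ.map ≤ I x ℓ ∧
          I x ℓ < e.shape x ℓ.map + (e.shape x ℓ.map - 1) * (Si x).eval ℓ.map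
            + (Sl x).eval ℓ.map ∧
          (I x ℓ - (Sl x).eval ℓ.map) % ((Si x).eval ℓ.map + 1) = 0)
        (e.scalarfArgs fun x ℓ => (I x ℓ - (Sl x).eval ℓ.map) / ((Si x).eval ℓ.map + 1))
  | _, .slice e Is _ Ip, I =>
      e.scalarfArgs fun x ℓ => (Is x).eval ℓ.map + I x ℓ * (Ip x).eval ℓ.map
  | _, .dySlice e J _, I => e.scalarfArgs fun x ℓ => I x ℓ + (J x).eval ℓ.map
  | _, .dyupSlice e eu J, I =>
      insert
        (.inr fun x ℓ => x ∈ e.axes → (J x).eval ℓ.map ≤ I x ℓ ∧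
          I x ℓ < (J x).eval ℓ.map + eu.shape x ℓ.map)
        ((eu.scalarfArgs fun x ℓ => I x ℓ - (J x).eval ℓ.map) ∪ e.scalarfArgs I)
  | _, .reduce _ e X l, I => e.scalarfArgs (I.withSI l X)
  | _, .relabel e R, I => e.scalarfArgs fun x => I ⟨x.1, R x.1 x.2⟩
  | _, .concat e e' x₀, I =>
      insert
        (.inr fun x ℓ => x ∈ e.axes → (if x = x₀ then e.shape x ℓ.map else 0) ≤ I x ℓ)
        ((e'.scalarfArgs fun x ℓ => I x ℓ - if x = x₀ then e.shape x ℓ.map else 0) ∪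
          e.scalarfArgs I)
  | _, .convBase ei ew Xb Xf _ Ip l, I =>
      (ei.scalarfArgs fun x ℓ =>
        if x ∈ Xf then ℓ.si l x.2
        else if x ∈ ei.axes \ (Xb ∪ Xf) then I x ℓ * (Ip x).eval ℓ.map + ℓ.si l x.2
        else I x ℓ) ∪
      ew.scalarfArgs (I.withSI l (Xf ∪ (ei.axes \ (Xb ∪ Xf))))
  | _, .dot e e' Xc _ l, I => e.scalarfArgs (I.withSI l Xc) ∪ e'.scalarfArgs (I.withSI l Xc)
  | _, .select eb e e', I => eb.scalarfArgs I ∪ (e.scalarfArgs I ∪ e'.scalarfArgs I)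
  | _, .reverse e X, I =>
      e.scalarfArgs fun x ℓ => if x ∈ X then e.shape x ℓ.map - I x ℓ - 1 else I x ℓ

/-- The general access. -/
def generalAccess (S : Sig) : SymIdx S := fun x ℓ => ℓ.acc x.2

/-- The distinct accesses and conditions of both sides of a rule. -/
def Rule.scalarfArgs (R : Rule S) : Finset (SymAccess S ⊕ SymCond S) :=
  R.lhs.scalarfArgs (generalAccess S) ∪ R.rhs.scalarfArgs (generalAccess S)

/-- The input tensors occurring in an expression. -/
def Expr.tensors : {τ : DType} → Expr S τ → Finset S.TVar
  | _, .lit _ _ _ => ∅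
  | _, .var t => {t}
  | _, .const _ _ _ => ∅
  | _, .iota _ _ _ => ∅
  | _, .expand e _ _ => e.tensors
  | _, .binary _ e e' => e.tensors ∪ e'.tensors
  | _, .padLow e _ _ => e.tensors
  | _, .pad e _ _ _ _ => e.tensors
  | _, .slice e _ _ _ => e.tensors
  | _, .dySlice e _ _ => e.tensors
  | _, .dyupSlice e eu _ => e.tensors ∪ eu.tensors
  | _, .reduce _ e _ _ => e.tensors
  | _, .relabel e _ => e.tensors
  | _, .concat e e' _ => e.tensors ∪ e'.tensors
  | _, .convBase ei ew _ _ _ _ _ => ei.tensors ∪ ew.tensors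
  | _, .dot e e' _ _ _ => e.tensors ∪ e'.tensors
  | _, .select eb e e' => eb.tensors ∪ (e.tensors ∪ e'.tensors)
  | _, .reverse e _ => e.tensors

/-- The input tensors that have an aggregated axis of rank class `c`. -/
def Rule.tensorsWithRClass (R : Rule S) (c : S.RClass) : Finset S.TVar :=
  (R.lhs.tensors ∪ R.rhs.tensors).filter fun t => ∃ x ∈ S.taxes t, x.1 = c

/-- The number of distinct accesses to the input tensor `t`. -/
def Rule.numTensorAccess (R : Rule S) (t : S.TVar) : ℕ :=
  (R.scalarfArgs.filter fun a => ∃ I, a = .inl ⟨t, I⟩).card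

/-- The number of distinct conditions that have a nontrivial fold over an aggregated axis of rank
class `c`. -/
def Rule.numConds (R : Rule S) (c : S.RClass) : ℕ :=
  (R.scalarfArgs.filter fun a =>
    ∃ b : SymCond S, a = .inr b ∧ ∃ (x : S.Axis c) (ℓ : Loc S c), ¬ b ⟨c, x⟩ ℓ).card

/-- The bound for the rank class `c`. -/
def Rule.inferBound (R : Rule S) (c : S.RClass) : ℕ :=
  Max.max
    ((∑ t ∈ R.tensorsWithRClass c,
      if 1 < R.numTensorAccess t then (R.numTensorAccess t).choose 2 else 0) + R.numConds c)
    1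

end

end TensorDSL

namespace TensorDSL

open Classical

noncomputable section

variable {S : Sig} {m r : S.RClass → ℕ}

/-! ### Restriction to selected positions -/

/-! Everything in the language acts position by position: at a named axis, sizes, attributes and
index transformations involve only the values at the same position of the same rank class. Values at
ranks `m` can therefore be restricted along any selection `ι` of positions, giving an instance of
the rule at smaller ranks. Hypotheses survive restriction, since validity, preconditions, access
ranges and hints are universal over positions, up to rank-independent clauses and the monotone
connectives `∧`, `∨`.

The conclusions of rule validity return to ranks `m` in two different ways. Validity of the right
side, equality of axes and shapes, and bijectivity of the hint are local: they hold if they hold at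
every tuple consisting of one position per class, so rank one suffices (`Expr.Valid.of_points`,
`Rule.HintBijective.of_points`).

Equality of elements is not local, because a condition is a conjunction over all positions and a
tensor is read at all positions at once. For one fixed access and fixed values of the reduction
indices, however, evaluation consults only finitely many truth values of conditions and tensor
entries. A false condition is refuted at one position, and two different accesses to a tensor differ
at one position. Retaining these witnesses costs at most one position per condition and one per
unordered pair of accesses to a tensor, which is the bound (`Rule.exists_separating_positions`).
True conditions stay true under any restriction. As distinct accesses stay distinct, tensor contents
at the smaller ranks can be defined that reproduce the entries read (`Rule.exists_faithful`). Both
sides then have unchanged elements (`Expr.denote_restrict`), and agreement at the small ranks is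
agreement at `m`. -/

/-- Restriction of the values of map variables along a selection of positions. -/
def MapEnv.restrict (ρ : MapEnv S m) (ι : ∀ c, Fin (r c) → Fin (m c)) : MapEnv S r :=
  fun c v i => ρ c v (ι c i)

/-- Restriction of an access along a selection of positions. -/
def Idx.restrict (A : Idx S m) (ι : ∀ c, Fin (r c) → Fin (m c)) : Idx S r :=
  fun x i => A x (ι x.1 i)

/-- Restriction of the values of symbolic reduction indices along a selection of positions. -/
def SIEnv.restrict (s : SIEnv S m) (ι : ∀ c, Fin (r c) → Fin (m c)) : SIEnv S r :=
  fun l x i => s l x (ι x.1 i)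

theorem AllOn.restrict {D : Finset S.Agg} {p : ∀ x : S.Agg, Fin (m x.1) → Prop}
    (h : AllOn m D p) (ι : ∀ c, Fin (r c) → Fin (m c)) :
    AllOn r D fun x i => p x (ι x.1 i) :=
  fun x hx i => h x hx (ι x.1 i)

/-- Each premise of an operator is either a relation between axis sets, which does not see the
ranks, or a statement about all positions. -/
theorem Expr.Valid.restrict {ρ : MapEnv S m} {τ : DType} {e : Expr S τ} (h : e.Valid ρ)
    (ι : ∀ c, Fin (r c) → Fin (m c)) : e.Valid (ρ.restrict ι) := by
  induction e with
  | lit => trivial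
  | var t => exact AllOn.restrict h ι
  | const v D sh => exact AllOn.restrict h ι
  | iota D sh x => exact ⟨h.1, h.2.restrict ι⟩
  | expand e D sh ih => exact ⟨ih h.1, h.2.1, h.2.2.restrict ι⟩
  | binary op e e' ih ih' => exact ⟨ih h.1, ih' h.2.1, h.2.2.1, h.2.2.2.restrict ι⟩
  | padLow e v Sl ih => exact ⟨ih h.1, h.2.restrict ι⟩
  | pad e v Sl Sh Si ih => exact ⟨ih h.1, h.2.restrict ι⟩
  | slice e Is Ie Ip ih => exact ⟨ih h.1, h.2.restrict ι⟩
  | dySlice e I sh ih => exact ⟨ih h.1, h.2.restrict ι⟩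
  | dyupSlice e eu I ih ih' => exact ⟨ih h.1, ih' h.2.1, h.2.2.1, h.2.2.2.restrict ι⟩
  | reduce op e X l ih => exact ⟨ih h.1, h.2⟩
  | relabel e R ih => exact ih h
  | concat e e' x ih ih' =>
    exact ⟨ih h.1, ih' h.2.1, h.2.2.1, h.2.2.2.1, h.2.2.2.2.restrict ι⟩
  | convBase ei ew Xb Xf Xo Ip l ih ih' =>
    obtain ⟨h1, h2, h3, h4, h5, h6, h7⟩ := h
    exact ⟨ih h1, ih' h2, h3, h4, h5, h6.restrict ι, h7.restrict ι⟩
  | dot e e' Xc Xb l ih ih' =>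
    obtain ⟨h1, h2, h3, h4, h5⟩ := h
    exact ⟨ih h1, ih' h2, h3, h4, h5.restrict ι⟩
  | select eb e e' ihb ih ih' =>
    obtain ⟨h1, h2, h3, h4, h5, h6, h7⟩ := h
    exact ⟨ihb h1, ih h2, ih' h3, h4, h5, h6.restrict ι, h7.restrict ι⟩
  | reverse e X ih => exact ⟨ih h.1, h.2⟩

/-- Preconditions contain no negation, so the truth of folds is inherited by fewer positions. The
converse from single positions fails for disjunctions, but preconditions are only ever needed in
this direction. -/
theorem Pre.Holds.restrict {ρ : MapEnv S m} {p : Pre S} (h : p.Holds ρ)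
    (ι : ∀ c, Fin (r c) → Fin (m c)) : p.Holds (ρ.restrict ι) := by
  induction p with
  | fold F => exact fun i => h (ι _ i)
  | and p q ihp ihq => exact ⟨ihp h.1, ihq h.2⟩
  | or p q ihp ihq => exact h.imp ihp ihq

theorem Expr.InRange.restrict {ρ : MapEnv S m} {s : SIEnv S m} {τ : DType} {e : Expr S τ}
    (h : e.InRange ρ s) (ι : ∀ c, Fin (r c) → Fin (m c)) :
    e.InRange (ρ.restrict ι) (s.restrict ι) :=
  fun o ho i => h o ho (ι _ i)

theorem Rule.Related.restrict {R : Rule S} {ρ : MapEnv S m} {s : SIEnv S m}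
    (h : R.Related ρ s) (ι : ∀ c, Fin (r c) → Fin (m c)) :
    R.Related (ρ.restrict ι) (s.restrict ι) :=
  ⟨h.1.restrict ι, h.2.1.restrict ι, fun F hF i => h.2.2 F hF (ι _ i)⟩

theorem AgreeOn.restrict {I : Finset S.SI} {s s' : SIEnv S m} (h : AgreeOn I s s')
    (ι : ∀ c, Fin (r c) → Fin (m c)) : AgreeOn I (s.restrict ι) (s'.restrict ι) :=
  fun p hp => funext fun i => congrFun (h p hp) (ι _ i)

theorem Expr.IsAccess.restrict {ρ : MapEnv S m} {A : Idx S m} {τ : DType} {e : Expr S τ}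
    (h : e.IsAccess ρ A) (ι : ∀ c, Fin (r c) → Fin (m c)) :
    e.IsAccess (ρ.restrict ι) (A.restrict ι) :=
  AllOn.restrict h ι

/-! ### Selecting one position of each rank class -/

/-- The selection of a single position in each rank class. -/
def point (i : ∀ c, Fin (m c)) : ∀ c : S.RClass, Fin ((fun _ => 1 : S.RClass → ℕ) c) → Fin (m c) :=
  fun c _ => i c

theorem exists_position (hm : ∀ c, 1 ≤ m c) (c : S.RClass) (i : Fin (m c)) :
    ∃ j : ∀ c, Fin (m c), j c = i :=
  ⟨Function.update (fun c => ⟨0, hm c⟩) c i, Function.update_self ..⟩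

theorem AllOn.of_points (hm : ∀ c, 1 ≤ m c) {D : Finset S.Agg}
    {p : ∀ x : S.Agg, Fin (m x.1) → Prop}
    (h : ∀ i : ∀ c, Fin (m c), AllOn (fun _ => 1) D fun x j => p x (point i x.1 j)) :
    AllOn m D p := by
  intro x hx i
  obtain ⟨j, rfl⟩ := exists_position hm x.1 i
  exact h j x hx 0

/-- Positional premises are collected over all tuples of positions; the rank-independent ones are
read off at any single tuple, which exists because all ranks are positive. -/
theorem Expr.Valid.of_points (hm : ∀ c, 1 ≤ m c) {ρ : MapEnv S m} {τ : DType} {e : Expr S τ}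
    (h : ∀ i, e.Valid (ρ.restrict (point i))) : e.Valid ρ := by
  have i₀ : ∀ c, Fin (m c) := fun c => ⟨0, hm c⟩
  induction e with
  | lit => trivial
  | var t => exact AllOn.of_points hm h
  | const v D sh => exact AllOn.of_points hm h
  | iota D sh x => exact ⟨(h i₀).1, AllOn.of_points hm fun i => (h i).2⟩
  | expand e D sh ih =>
    exact ⟨ih fun i => (h i).1, (h i₀).2.1, AllOn.of_points hm fun i => (h i).2.2⟩
  | binary op e e' ih ih' =>
    exact ⟨ih fun i => (h i).1, ih' fun i => (h i).2.1, (h i₀).2.2.1,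
      AllOn.of_points hm fun i => (h i).2.2.2⟩
  | padLow e v Sl ih => exact ⟨ih fun i => (h i).1, AllOn.of_points hm fun i => (h i).2⟩
  | pad e v Sl Sh Si ih => exact ⟨ih fun i => (h i).1, AllOn.of_points hm fun i => (h i).2⟩
  | slice e Is Ie Ip ih => exact ⟨ih fun i => (h i).1, AllOn.of_points hm fun i => (h i).2⟩
  | dySlice e I sh ih => exact ⟨ih fun i => (h i).1, AllOn.of_points hm fun i => (h i).2⟩
  | dyupSlice e eu I ih ih' =>
    exact ⟨ih fun i => (h i).1, ih' fun i => (h i).2.1, (h i₀).2.2.1,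
      AllOn.of_points hm fun i => (h i).2.2.2⟩
  | reduce op e X l ih => exact ⟨ih fun i => (h i).1, (h i₀).2⟩
  | relabel e R ih => exact ih h
  | concat e e' x ih ih' =>
    exact ⟨ih fun i => (h i).1, ih' fun i => (h i).2.1, (h i₀).2.2.1, (h i₀).2.2.2.1,
      AllOn.of_points hm fun i => (h i).2.2.2.2⟩
  | convBase ei ew Xb Xf Xo Ip l ih ih' =>
    exact ⟨ih fun i => (h i).1, ih' fun i => (h i).2.1, (h i₀).2.2.1, (h i₀).2.2.2.1,
      (h i₀).2.2.2.2.1, AllOn.of_points hm fun i => (h i).2.2.2.2.2.1,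
      AllOn.of_points hm fun i => (h i).2.2.2.2.2.2⟩
  | dot e e' Xc Xb l ih ih' =>
    exact ⟨ih fun i => (h i).1, ih' fun i => (h i).2.1, (h i₀).2.2.1, (h i₀).2.2.2.1,
      AllOn.of_points hm fun i => (h i).2.2.2.2⟩
  | select eb e e' ihb ih ih' =>
    exact ⟨ihb fun i => (h i).1, ih fun i => (h i).2.1, ih' fun i => (h i).2.2.1,
      (h i₀).2.2.2.1, (h i₀).2.2.2.2.1, AllOn.of_points hm fun i => (h i).2.2.2.2.2.1,
      AllOn.of_points hm fun i => (h i).2.2.2.2.2.2⟩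
  | reverse e X ih => exact ⟨ih fun i => (h i).1, (h i₀).2⟩

theorem Expr.SIConsistent.of_points (hm : ∀ c, 1 ≤ m c) {ρ : MapEnv S m} {τ : DType}
    {e : Expr S τ} (h : ∀ i, e.SIConsistent (ρ.restrict (point i))) : e.SIConsistent ρ := by
  intro l x f g hf hg i
  obtain ⟨j, rfl⟩ := exists_position hm x.1 i
  exact h j l x f g hf hg 0

theorem AgreeOn.of_points (hm : ∀ c, 1 ≤ m c) {I : Finset S.SI} {s s' : SIEnv S m}
    (h : ∀ i, AgreeOn I (s.restrict (point i)) (s'.restrict (point i))) : AgreeOn I s s' := by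
  intro p hp
  funext i
  obtain ⟨j, rfl⟩ := exists_position hm p.2.1 i
  exact congrFun (h j p hp) 0

/-- Related values of the symbolic indices can be found position by position. -/
theorem Rule.exists_related_of_points (hm : ∀ c, 1 ≤ m c) {R : Rule S} {ρ : MapEnv S m}
    {I : Finset S.SI} {s : SIEnv S m}
    (h : ∀ i, ∃ s', AgreeOn I (s.restrict (point i)) s' ∧ R.Related (ρ.restrict (point i)) s') :
    ∃ s', AgreeOn I s s' ∧ R.Related ρ s' := by
  choose s' hI hR using h
  choose j hj using exists_position hm
  -- Gluing: `j c i` is a tuple of positions passing through `i` in class `c`, and the value at that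
  -- position is copied from the rank-one solution for this tuple. Different positions may use
  -- unrelated solutions, since range conditions and hint folds involve only one position of one
  -- class at a time.
  refine ⟨fun l x i => s' (j x.1 i) l x 0, ?_, ?_, ?_, ?_⟩
  · intro p hp
    funext i
    have := congrFun (hI (j _ i) p hp) 0
    simpa [SIEnv.restrict, point, hj] using this
  · intro o ho i
    have := (hR (j _ i)).1 o ho 0
    have e : (ρ.restrict (point (j _ i))).at o.2.1.1 0 = ρ.at o.2.1.1 i := by
      funext v; simp [MapEnv.at, MapEnv.restrict, point, hj]
    rwa [e] at this
  · intro o ho i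
    have := (hR (j _ i)).2.1 o ho 0
    have e : (ρ.restrict (point (j _ i))).at o.2.1.1 0 = ρ.at o.2.1.1 i := by
      funext v; simp [MapEnv.at, MapEnv.restrict, point, hj]
    rwa [e] at this
  · intro F hF i
    have := (hR (j _ i)).2.2 F hF 0
    simpa [MapEnv.restrict, point, hj] using this

/-- Agreement and relatedness pass to single positions, while agreement can be reassembled from them
and related values glued. Hence both existence clauses and the equivalence expressing functionality
and injectivity are local. -/
theorem Rule.HintBijective.of_points (hm : ∀ c, 1 ≤ m c) {R : Rule S} {ρ : MapEnv S m}
    (h : ∀ i, R.HintBijective (ρ.restrict (point i))) : R.HintBijective ρ := by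
  refine ⟨.of_points hm fun i => (h i).1, .of_points hm fun i => (h i).2.1, ?_, ?_, ?_⟩
  · exact fun s hs => exists_related_of_points hm fun i => (h i).2.2.1 _ (hs.restrict _)
  · exact fun s hs => exists_related_of_points hm fun i => (h i).2.2.2.1 _ (hs.restrict _)
  · intro s s' hs hs'
    have key := fun i => (h i).2.2.2.2 _ _ (hs.restrict (point i)) (hs'.restrict (point i))
    exact ⟨fun ha => .of_points hm fun i => (key i).1 (ha.restrict _),
      fun ha => .of_points hm fun i => (key i).2 (ha.restrict _)⟩

/-! ### Symbolic evaluation determines elements -/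

/-- The local values at a named axis. -/
def locAt (ρ : MapEnv S m) (s : SIEnv S m) (A : Idx S m) (c : S.RClass) (i : Fin (m c)) :
    Loc S c where
  map := ρ.at c i
  si l a := s l ⟨c, a⟩ i
  acc a := A ⟨c, a⟩ i

/-- A symbolic access at given local values. -/
def SymIdx.inst (I : SymIdx S) (L : ∀ c, Fin (m c) → Loc S c) : Idx S m :=
  fun x i => I x (L x.1 i)

/-- All accesses and conditions in `F` evaluate in the same way before and after restriction to
selected positions. -/
def Faithful (L : ∀ c, Fin (m c) → Loc S c) (ι : ∀ c, Fin (r c) → Fin (m c))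
    (θ : TenEnv S m) (θ' : TenEnv S r) (F : Finset (SymAccess S ⊕ SymCond S)) : Prop :=
  (∀ t J, .inl ⟨t, J⟩ ∈ F →
    θ' t (fun x i => J x (L x.1.1 (ι x.1.1 i))) = θ t (fun x i => J x (L x.1.1 i))) ∧
  ∀ b, .inr b ∈ F → (∀ x i, b x (L x.1 (ι x.1 i))) → ∀ x i, b x (L x.1 i)

theorem Faithful.mono {L : ∀ c, Fin (m c) → Loc S c} {ι : ∀ c, Fin (r c) → Fin (m c)}
    {θ : TenEnv S m} {θ' : TenEnv S r} {F G : Finset (SymAccess S ⊕ SymCond S)}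
    (h : Faithful L ι θ θ' G) (hFG : F ⊆ G) : Faithful L ι θ θ' F :=
  ⟨fun t J hJ => h.1 t J (hFG hJ), fun b hb => h.2 b (hFG hb)⟩

/-- A condition on all named axes has the same truth value after a faithful restriction. -/
theorem Faithful.allOn_iff {L : ∀ c, Fin (m c) → Loc S c} {ι : ∀ c, Fin (r c) → Fin (m c)}
    {θ : TenEnv S m} {θ' : TenEnv S r} {F : Finset (SymAccess S ⊕ SymCond S)}
    (h : Faithful L ι θ θ' F) {D : Finset S.Agg} {b : SymCond S}
    (hb : .inr (fun x ℓ => x ∈ D → b x ℓ) ∈ F) :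
    (AllOn r D fun x i => b x (L x.1 (ι x.1 i))) ↔ AllOn m D fun x i => b x (L x.1 i) :=
  ⟨fun H x hx i => h.2 _ hb (fun x _ hx => H x hx _) x i hx, fun H x hx i => H x hx _⟩

/-- Literals and iota inspect only the first position of an axis. This is harmless because such axes
are singletons, before and after restriction, so the selection is forced. -/
theorem dite_pos_restrict {α : Type*} [Zero α] {k n : ℕ} (hk : k = 1) (hn : n = 1)
    (f : Fin n → α) (ι : Fin k → Fin n) :
    (if h : 0 < k then f (ι ⟨0, h⟩) else 0) = if h : 0 < n then f ⟨0, h⟩ else 0 := by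
  subst hk hn
  simp [Subsingleton.elim (ι 0) 0]

/-- Ranks and tensor contents influence an element only through conditions, tensor reads and
singleton axes. The first two are preserved by faithfulness, the last by admissibility; the index
sets and operators of reduction elements do not depend on the ranks. -/
theorem Expr.denote_restrict {ρ : MapEnv S m} {s : SIEnv S m} {A : Idx S m}
    {ι : ∀ c, Fin (r c) → Fin (m c)} {θ : TenEnv S m} {θ' : TenEnv S r}
    {τ : DType} (e : Expr S τ) (I : SymIdx S)
    (hm : ∀ x ∈ e.singletons, m x.1 = 1) (hr : ∀ x ∈ e.singletons, r x.1 = 1)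
    (h : Faithful (locAt ρ s A) ι θ θ' (e.scalarfArgs I)) :
    e.denote (ρ.restrict ι) θ' (s.restrict ι) (I.inst fun c i => locAt ρ s A c (ι c i)) =
      e.denote ρ θ s (I.inst (locAt ρ s A)) := by
  -- Operators pass a transformed access to their operands, hence the generalization over `I`; the
  -- local values remain those of the original access. Instantiating the symbolic transformation
  -- yields the concrete access by definition, so most cases reduce to congruence.
  induction e generalizing I with
  | lit D size f =>
    refine congrArg (fun a => Elem.val (f a)) (funext fun x => ?_)
    exact dite_pos_restrict (hr _ x.2) (hm _ x.2) (fun i => I x.1 (locAt ρ s A x.1.1 i)) _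
  | var t => exact congrArg Elem.val (h.1 t _ (Finset.mem_singleton_self _))
  | const v D sh => rfl
  | iota D sh x =>
    have hx := Finset.mem_singleton_self x
    exact congrArg (Elem.val (τ := .int))
      (dite_pos_restrict (hr _ hx) (hm _ hx) (fun i => I x (locAt ρ s A x.1 i)) _)
  | expand e D sh ih => exact ih I hm hr h
  | binary op e e' ih ih' =>
    exact congrArg₂ (Elem.binary op)
      (ih I (fun x hx => hm x (Finset.mem_union_left _ hx))
        (fun x hx => hr x (Finset.mem_union_left _ hx)) (h.mono Finset.subset_union_left))
      (ih' I (fun x hx => hm x (Finset.mem_union_right _ hx))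
        (fun x hx => hr x (Finset.mem_union_right _ hx)) (h.mono Finset.subset_union_right))
  | padLow e v Sl ih =>
    exact if_congr (h.allOn_iff (Finset.mem_insert_self _ _))
      (ih _ hm hr (h.mono (Finset.subset_insert _ _))) rfl
  | pad e v Sl Sh Si ih =>
    exact if_congr (h.allOn_iff (Finset.mem_insert_self _ _))
      (ih _ hm hr (h.mono (Finset.subset_insert _ _))) rfl
  | slice e Is Ie Ip ih => exact ih _ hm hr h
  | dySlice e J sh ih => exact ih _ hm hr h
  | dyupSlice e eu J ih ih' =>
    have h' := h.mono (Finset.subset_insert _ _)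
    exact if_congr (h.allOn_iff (Finset.mem_insert_self _ _))
      (ih' _ (fun x hx => hm x (Finset.mem_union_right _ hx))
        (fun x hx => hr x (Finset.mem_union_right _ hx)) (h'.mono Finset.subset_union_left))
      (ih I (fun x hx => hm x (Finset.mem_union_left _ hx))
        (fun x hx => hr x (Finset.mem_union_left _ hx)) (h'.mono Finset.subset_union_right))
  | reduce op e X l ih => exact congrArg (Elem.reduce op _) (ih _ hm hr h)
  | relabel e R ih => exact ih _ hm hr h
  | concat e e' x ih ih' =>
    have h' := h.mono (Finset.subset_insert _ _)
    have hs {y} (hy : y ∈ e.singletons ∪ e'.singletons) :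
        y ∈ insert x (e.singletons ∪ e'.singletons) := Finset.mem_insert_of_mem hy
    exact if_congr (h.allOn_iff (Finset.mem_insert_self _ _))
      (ih' _ (fun x hx => hm x (hs (Finset.mem_union_right _ hx)))
        (fun x hx => hr x (hs (Finset.mem_union_right _ hx))) (h'.mono Finset.subset_union_left))
      (ih I (fun x hx => hm x (hs (Finset.mem_union_left _ hx)))
        (fun x hx => hr x (hs (Finset.mem_union_left _ hx))) (h'.mono Finset.subset_union_right))
  | convBase ei ew Xb Xf Xo Ip l ih ih' =>
    exact congrArg (Elem.reduce _ _) (congrArg₂ (Elem.binary _)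
      (ih _ (fun x hx => hm x (Finset.mem_union_left _ hx))
        (fun x hx => hr x (Finset.mem_union_left _ hx)) (h.mono Finset.subset_union_left))
      (ih' _ (fun x hx => hm x (Finset.mem_union_right _ hx))
        (fun x hx => hr x (Finset.mem_union_right _ hx)) (h.mono Finset.subset_union_right)))
  | dot e e' Xc Xb l ih ih' =>
    exact congrArg (Elem.reduce _ _) (congrArg₂ (Elem.binary _)
      (ih _ (fun x hx => hm x (Finset.mem_union_left _ hx))
        (fun x hx => hr x (Finset.mem_union_left _ hx)) (h.mono Finset.subset_union_left))
      (ih' _ (fun x hx => hm x (Finset.mem_union_right _ hx))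
        (fun x hx => hr x (Finset.mem_union_right _ hx)) (h.mono Finset.subset_union_right)))
  | select eb e e' ihb ih ih' =>
    have h' := h.mono Finset.subset_union_right
    have hs {y} (hy : y ∈ e.singletons ∪ e'.singletons) :=
      Finset.mem_union_right eb.singletons hy
    have h1 := ihb I (fun x hx => hm x (Finset.mem_union_left _ hx))
        (fun x hx => hr x (Finset.mem_union_left _ hx)) (h.mono Finset.subset_union_left)
    have h2 := ih I (fun x hx => hm x (hs (Finset.mem_union_left _ hx)))
        (fun x hx => hr x (hs (Finset.mem_union_left _ hx))) (h'.mono Finset.subset_union_left)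
    have h3 := ih' I (fun x hx => hm x (hs (Finset.mem_union_right _ hx)))
        (fun x hx => hr x (hs (Finset.mem_union_right _ hx)))
        (h'.mono Finset.subset_union_right)
    simp only [Expr.denote, h1, h2, h3]
  | reverse e X ih => exact ih _ hm hr h

theorem Expr.mem_tensors_of_mem_scalarfArgs {τ : DType} (e : Expr S τ) (I : SymIdx S)
    {a : SymAccess S} (h : .inl a ∈ e.scalarfArgs I) : a.1 ∈ e.tensors := by
  induction e generalizing I <;>
    simp only [Expr.scalarfArgs, Expr.tensors, Finset.notMem_empty, Finset.mem_singleton,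
      Finset.mem_insert, Finset.mem_union, reduceCtorEq, false_or, Sum.inl.injEq] at h ⊢ <;>
    grind

/-! ### Selecting enough positions -/

/-- Each element of `F` names at most one position among all classes together, and distinct
positions of class `c` must be named by distinct elements. -/
theorem card_positions_le {α : Type*} (F : Finset α) (w : α → Option (Σ c, Fin (m c)))
    (c : S.RClass) :
    (Finset.univ.filter fun i => ∃ a ∈ F, w a = some ⟨c, i⟩).card ≤ F.card := by
  have hinj : Function.Injective fun i : Fin (m c) => (some ⟨c, i⟩ : Option (Σ c, Fin (m c))) := by
    intro i j h
    simpa using h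
  rw [← Finset.card_image_of_injective _ hinj]
  refine (Finset.card_le_card ?_).trans (Finset.card_image_le (s := F) (f := w))
  intro y hy
  simp only [Finset.mem_image, Finset.mem_filter, Finset.mem_univ, true_and] at hy ⊢
  obtain ⟨i, ⟨a, ha, hw⟩, rfl⟩ := hy
  exact ⟨a, ha, hw⟩

/-- Finitely many positions, no more than the bound in each rank class, refute every false condition
and separate any two accesses to an input tensor that differ. -/
theorem Rule.exists_separating_positions (R : Rule S) (L : ∀ c, Fin (m c) → Loc S c) :
    ∃ K : ∀ c, Finset (Fin (m c)), (∀ c, (K c).card ≤ R.inferBound c) ∧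
      (∀ b, .inr b ∈ R.scalarfArgs → (∀ x : S.Agg, ∀ i ∈ K x.1, b x (L x.1 i)) → ∀ x i, b x (L x.1 i)) ∧
      ∀ t J J', .inl ⟨t, J⟩ ∈ R.scalarfArgs → .inl ⟨t, J'⟩ ∈ R.scalarfArgs →
        (∀ x : S.taxes t, ∀ i ∈ K x.1.1, J x (L x.1.1 i) = J' x (L x.1.1 i)) →
        ∀ x i, J x (L x.1.1 i) = J' x (L x.1.1 i) := by
  -- One refuting position is chosen per condition; it lies in the class of the axis whose fold
  -- fails.
  have hw : ∀ a : SymAccess S ⊕ SymCond S, ∃ w : Option (Σ c, Fin (m c)),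
      ∀ b, a = .inr b → (∃ x i, ¬ b x (L x.1 i)) →
        ∃ x i, w = some ⟨x.1, i⟩ ∧ ¬ b x (L x.1 i) := by
    intro a
    by_cases h : ∃ b : SymCond S, a = .inr b ∧ ∃ x i, ¬ b x (L x.1 i)
    · obtain ⟨b, rfl, x, i, hb⟩ := h
      refine ⟨some ⟨x.1, i⟩, ?_⟩
      rintro b' h -
      cases h
      exact ⟨x, i, rfl, hb⟩
    · exact ⟨none, fun b hb hx => (h ⟨b, hb, hx⟩).elim⟩
  -- Witnesses are indexed by unordered pairs, so that the count is a binomial coefficient. This is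
  -- legitimate because a position separating `J` from `J'` also separates `J'` from `J`.
  have hv : ∀ P : Finset (SymAccess S ⊕ SymCond S), ∃ w : Option (Σ c, Fin (m c)),
      ∀ t J J', P = {.inl ⟨t, J⟩, .inl ⟨t, J'⟩} → (∃ x i, J x (L x.1.1 i) ≠ J' x (L x.1.1 i)) →
        ∃ x i, w = some ⟨x.1.1, i⟩ ∧ J x (L x.1.1 i) ≠ J' x (L x.1.1 i) := by
    intro P
    by_cases h : ∃ t J J', P = {.inl ⟨t, J⟩, .inl ⟨t, J'⟩} ∧
        ∃ x i, J x (L x.1.1 i) ≠ J' x (L x.1.1 i)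
    · obtain ⟨t, J, J', rfl, x, i, hJ⟩ := h
      refine ⟨some ⟨x.1.1, i⟩, ?_⟩
      intro t' K K' hP hK
      have hset : ({.inl ⟨t, J⟩, .inl ⟨t, J'⟩} : Set (SymAccess S ⊕ SymCond S)) =
          {.inl ⟨t', K⟩, .inl ⟨t', K'⟩} := by
        have := congrArg (fun s : Finset (SymAccess S ⊕ SymCond S) =>
          (s : Set (SymAccess S ⊕ SymCond S))) hP
        simpa using this
      rcases Set.pair_eq_pair_iff.1 hset with ⟨h1, h2⟩ | ⟨h1, h2⟩
      · cases h1
        cases h2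
        exact ⟨x, i, rfl, hJ⟩
      · cases h1
        cases h2
        exact ⟨x, i, rfl, hJ.symm⟩
    · exact ⟨none, fun t J J' hP hx => (h ⟨t, J, J', hP, hx⟩).elim⟩
  choose w hw using hw
  choose v hv using hv
  let acc (t : S.TVar) := R.scalarfArgs.filter fun a => ∃ I, a = .inl ⟨t, I⟩
  let conds (c : S.RClass) := R.scalarfArgs.filter fun a =>
    ∃ b : SymCond S, a = .inr b ∧ ∃ (x : S.Axis c) (ℓ : Loc S c), ¬ b ⟨c, x⟩ ℓ
  let Kp (c : S.RClass) (t : S.TVar) : Finset (Fin (m c)) :=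
    Finset.univ.filter fun i => ∃ P ∈ (acc t).powersetCard 2, v P = some ⟨c, i⟩
  let Kc (c : S.RClass) : Finset (Fin (m c)) :=
    Finset.univ.filter fun i => ∃ a ∈ conds c, w a = some ⟨c, i⟩
  refine ⟨fun c => (R.tensorsWithRClass c).biUnion (Kp c) ∪ Kc c, ?_, ?_, ?_⟩
  · intro c
    refine le_trans ?_ (le_max_left _ _)
    refine (Finset.card_union_le _ _).trans (add_le_add ?_ (card_positions_le (conds c) w c))
    refine Finset.card_biUnion_le.trans (Finset.sum_le_sum fun t _ => ?_)
    have h := card_positions_le ((acc t).powersetCard 2) v c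
    rw [Finset.card_powersetCard] at h
    -- The case distinction in the bound changes nothing: with fewer than two accesses the binomial
    -- coefficient is zero.
    split_ifs with ht
    · exact h
    · exact h.trans (Nat.choose_eq_zero_of_lt (show R.numTensorAccess t < 2 by omega)).le
  · intro b hb hK
    by_contra! hne
    obtain ⟨x, i, hx, hbx⟩ := hw _ b rfl hne
    refine hbx (hK x i (Finset.mem_union_right _ ?_))
    -- The refuting position itself shows that the fold on this axis is not identically true, so the
    -- condition is counted for this class.
    exact Finset.mem_filter.2 ⟨Finset.mem_univ _, .inr b,
      Finset.mem_filter.2 ⟨hb, b, rfl, x.2, _, hbx⟩, hx⟩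
  · intro t J J' hJ hJ' hK
    by_contra! hne
    obtain ⟨x, i, hx, hne'⟩ := hv _ t J J' rfl hne
    refine hne' (hK x i (Finset.mem_union_left _ (Finset.mem_biUnion.2 ⟨t, ?_, ?_⟩)))
    -- The separating position lies on an axis of `t`, so `t` contributes to the bound of that
    -- axis's class.
    · refine Finset.mem_filter.2 ⟨?_, x.1, x.2, rfl⟩
      rcases Finset.mem_union.1 hJ with h | h
      · exact Finset.mem_union_left _ (R.lhs.mem_tensors_of_mem_scalarfArgs _ h)
      · exact Finset.mem_union_right _ (R.rhs.mem_tensors_of_mem_scalarfArgs _ h)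
    · refine Finset.mem_filter.2 ⟨Finset.mem_univ _, _, Finset.mem_powersetCard.2 ⟨?_, ?_⟩, hx⟩
      · intro a ha
        simp only [Finset.mem_insert, Finset.mem_singleton] at ha
        rcases ha with rfl | rfl
        · exact Finset.mem_filter.2 ⟨hJ, J, rfl⟩
        · exact Finset.mem_filter.2 ⟨hJ', J', rfl⟩
      · refine Finset.card_pair fun h => ?_
        cases h
        exact hne' rfl

/-- Every choice of local values admits a faithful restriction to ranks within the bounds. -/
theorem Rule.exists_faithful (R : Rule S) (hm : ∀ c, 1 ≤ m c) (L : ∀ c, Fin (m c) → Loc S c)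
    (θ : TenEnv S m) :
    ∃ (r : S.RClass → ℕ) (ι : ∀ c, Fin (r c) → Fin (m c)) (θ' : TenEnv S r),
      (∀ c, 1 ≤ r c ∧ r c ≤ R.inferBound c) ∧ (∀ c, r c ≤ m c) ∧
      Faithful L ι θ θ' R.scalarfArgs := by
  obtain ⟨K, hK, hcond, hacc⟩ := R.exists_separating_positions L
  have hK' : ∀ c, ∃ K' : Finset (Fin (m c)), K c ⊆ K' ∧ 1 ≤ K'.card ∧
      K'.card ≤ R.inferBound c := by
    intro c
    rcases (K c).eq_empty_or_nonempty with h | h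
    -- A class without witnesses still needs positive rank. An arbitrary position is kept, which the
    -- maximum with `1` in the bound permits.
    · exact ⟨{⟨0, hm c⟩}, by simp [h], by simp, by simp [Rule.inferBound]⟩
    · exact ⟨K c, subset_rfl, h.card_pos, hK c⟩
  choose K' hsub hpos hle using hK'
  let ι : ∀ c, Fin (K' c).card → Fin (m c) := fun c i => ((K' c).equivFin.symm i).1
  have hι : ∀ c, ∀ i ∈ K c, ∃ j, ι c j = i := fun c i hi =>
    ⟨(K' c).equivFin ⟨i, hsub c hi⟩, by simp [ι]⟩
  -- The new contents at a restricted access are the old contents at the full access it comes from.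
  -- Entries that no access of the rule reads are set to zero.
  refine ⟨fun c => (K' c).card, ι, fun t a =>
    if h : ∃ J, .inl ⟨t, J⟩ ∈ R.scalarfArgs ∧ a = fun x i => J x (L x.1.1 (ι x.1.1 i))
    then θ t fun x i => h.choose x (L x.1.1 i) else (S.dtype t).zero,
    fun c => ⟨hpos c, hle c⟩, fun c => (card_finset_fin_le _), ?_, ?_⟩
  · intro t J hJ
    have h : ∃ J', .inl ⟨t, J'⟩ ∈ R.scalarfArgs ∧
        (fun (x : S.taxes t) (i : Fin (K' x.1.1).card) => J x (L x.1.1 (ι x.1.1 i))) =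
          fun x i => J' x (L x.1.1 (ι x.1.1 i)) := ⟨J, hJ, rfl⟩
    refine (dif_pos h).trans (congrArg (θ t) (funext₂ ?_))
    -- The chosen access may differ from `J` as a function, but both coincide on the retained
    -- positions. These separate accesses that differ at the given local values, so the two coincide
    -- at all positions.
    refine hacc t _ _ h.choose_spec.1 hJ fun x i hi => ?_
    obtain ⟨j, rfl⟩ := hι _ i hi
    exact (congrFun₂ h.choose_spec.2 x j).symm
  · intro b hb H
    refine hcond b hb fun x i hi => ?_
    obtain ⟨j, rfl⟩ := hι _ i hi
    exact H x j

/-! ### Transferring validity from bounded ranks to all ranks -/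

/-- Relatedness enters only as a hypothesis on the summands, so a stronger relation demands less. -/
theorem Elem.Agree.imp {τ : DType} {I J : Finset S.SI} {p q : Prop} (hpq : q → p)
    {u v : Elem S τ} (h : Elem.Agree I J p u v) : Elem.Agree I J q u v := by
  cases u <;> cases v <;> simp only [Elem.Agree] at h ⊢
  · exact h
  · exact ⟨h.1, h.2.1, h.2.2.1, fun hq => h.2.2.2 (hpq hq)⟩

/-- A class of rank one keeps rank one when its rank may shrink but must stay positive. -/
theorem Rule.Admissible.restrict {R : Rule S} (h : R.Admissible m) (h1 : ∀ c, 1 ≤ r c)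
    (hle : ∀ c, r c ≤ m c) : R.Admissible r :=
  fun x hx => le_antisymm ((hle _).trans (h x hx).le) (h1 _)

theorem Rule.valid_of_valid_le_inferBound (R : Rule S)
    (H : ∀ r : S.RClass → ℕ, (∀ c, 1 ≤ r c ∧ r c ≤ R.inferBound c) → R.Valid r)
    (hm : ∀ c, 1 ≤ m c) : R.Valid m := by
  intro hadm ρ θ hpre hlhs
  -- Rank one is always within the bounds. Only the conclusions that do not mention tensor contents
  -- are taken from these instances, so zero contents serve.
  have hpt : ∀ i : ∀ c, Fin (m c), _ := fun i =>
    H (fun _ => 1) (fun c => ⟨le_rfl, le_max_right _ _⟩)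
      (hadm.restrict (fun _ => le_rfl) hm) (ρ.restrict (point i)) (fun t _ => (S.dtype t).zero)
      (fun p hp => (hpre p hp).restrict _) (hlhs.restrict _)
  refine ⟨.of_points hm fun i => (hpt i).1, (hpt fun c => ⟨0, hm c⟩).2.1,
    .of_points hm fun i => (hpt i).2.2.1, .of_points hm fun i => (hpt i).2.2.2.1, ?_⟩
  intro A hA s
  -- The smaller ranks, the selection and the contents depend on the access and on the values of the
  -- reduction indices; one element comparison is treated at a time.
  obtain ⟨r, ι, θ', hr, hrm, hF⟩ := R.exists_faithful hm (locAt ρ s A) θ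
  have hadm' := hadm.restrict (fun c => (hr c).1) hrm
  have key := (H r hr hadm' (ρ.restrict ι) θ' (fun p hp => (hpre p hp).restrict _)
    (hlhs.restrict _)).2.2.2.2 (A.restrict ι) (hA.restrict ι) (s.restrict ι)
  have hl := R.lhs.denote_restrict (generalAccess S)
    (fun x hx => hadm x (Finset.mem_union_left _ hx))
    (fun x hx => hadm' x (Finset.mem_union_left _ hx)) (hF.mono Finset.subset_union_left)
  have hr := R.rhs.denote_restrict (generalAccess S)
    (fun x hx => hadm x (Finset.mem_union_right _ hx))
    (fun x hx => hadm' x (Finset.mem_union_right _ hx)) (hF.mono Finset.subset_union_right)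
  -- Related values remain related after restriction, which is the direction needed to transfer
  -- equality of summands back to ranks `m`.
  have := key.imp fun h : R.Related ρ s => h.restrict ι
  exact hl ▸ hr ▸ this

end

end TensorDSL

/-- A rule is valid at all positive ranks of its rank classes if and only if it is valid at all
ranks between `1` and the inferred bounds. -/
theorem mainTheorem1 (S : TensorDSL.Sig) [Fintype S.RClass] (R : TensorDSL.Rule S) :
    (∀ m : S.RClass → ℕ, (∀ c, 1 ≤ m c) → R.Valid m) ↔
      ∀ r : S.RClass → ℕ, (∀ c, 1 ≤ r c ∧ r c ≤ R.inferBound c) → R.Valid r :=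
  ⟨fun H r hr => H r fun c => (hr c).1, fun H _ hm => R.valid_of_valid_le_inferBound H hm⟩
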